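/- For $a\in\mathbb{R}$ and $j\ge 0$ let $k^{-a}(j)$ denote the $j$-th Taylor coefficient at the origin of the function $t\mapsto(1-t)^a$. For a sequence of real numbers $\Lambda=\{\Lambda_n\}_{n\ge0}$ put $$(1-\nabla)^a\Lambda_n:=\sum_{j=0}^{\infty}k^{-a}(j)\,\Lambda_{j+n}=\lim_{N\to\infty}\sum_{j=0}^{N}k^{-a}(j)\,\Lambda_{j+n}\qquad(n\ge0),$$ and say that $(1-\nabla)^a\Lambda$ is well defined if this series converges (not necessarily absolutely) for every $n\ge0$. Theorem. Let $\Lambda=\{\Lambda_n\}_{n\ge0}$ be a sequence of real numbers and let $0<b<a$, where $b$ is not an integer. If $(1-\nabla)^a\Lambda$ is well defined with $(1-\nabla)^a\Lambda_n\ge0$ for every $n\ge0$, and $(1-\nabla)^b\Lambda$ is well defined, then $(1-\nabla)^b\Lambda_n\ge0$ for every $n\ge0$. -/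

import Mathlib

/-- The Cesàro number `k^a(j)`: the `j`-th Taylor coefficient at the origin of `t ↦ (1 - t)^(-a)`. -/
noncomputable def cesaroNumber (a : ℝ) (j : ℕ) : ℝ :=
  iteratedDeriv j (fun t : ℝ => (1 - t) ^ (-a)) 0 / (j.factorial : ℝ)

/-- The `j`-th term `k^{-a}(j) Λ_{j+n}` of the series defining `(1 - ∇)^a Λ_n`. -/
noncomputable def fracDiffTerm (a : ℝ) (Λ : ℕ → ℝ) (n j : ℕ) : ℝ :=
  cesaroNumber (-a) j * Λ (j + n)

/-- `(1 - ∇)^a Λ` is well defined: for every `n` the defining series converges in the ordinary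
(possibly conditional) sense, i.e. its partial sums over `0, …, N` converge as `N → ∞`. -/
def FracDiffWellDefined (a : ℝ) (Λ : ℕ → ℝ) : Prop :=
  ∀ n : ℕ, Summable (fracDiffTerm a Λ n) (SummationFilter.conditional ℕ)

/-- The forward difference `(1 - ∇)^a Λ_n = ∑_{j ≥ 0} k^{-a}(j) Λ_{j+n}` of order `a`, the sum being
the limit of the partial sums. It is meaningful when `FracDiffWellDefined a Λ` holds. -/
noncomputable def fracDiff (a : ℝ) (Λ : ℕ → ℝ) (n : ℕ) : ℝ :=
  ∑'[SummationFilter.conditional ℕ] j, fracDiffTerm a Λ n j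

open Finset Filter Topology

/-! Formally `(1 - t)^b = (1 - t)^(b - a) * (1 - t)^a`, and the first factor has positive
coefficients, so the order-`b` difference is a positive combination of order-`a` differences.
Conditional convergence forbids exchanging the sums, so those coefficients are multiplied by the
taper `C(M - j, K) / C(M, K)` with `K > a`. The combination is then finite and nonnegative, and
equals the order-`b` series with its `m`-th term multiplied by `taperRatio a b K M m`. These
multipliers start at 1, and their increments tend to 0 as `M → ∞`. Their total variation is bounded
uniformly in `M`: up to `M` they are polynomial in `m` with increments `O(1/M)`, and beyond `M` they
are monotone of one sign. Abel summation (`nonneg_of_multipliers`) then passes nonnegativity to the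
limit. -/

/-- The coefficient `a (a + 1) ⋯ (a + j - 1) / j!` of `t ^ j` in `(1 - t) ^ (-a)`. -/
noncomputable def risingCoeff (a : ℝ) : ℕ → ℝ
  | 0 => 1
  | j + 1 => risingCoeff a j * (a + j) / (j + 1)

@[simp]
lemma risingCoeff_zero (a : ℝ) : risingCoeff a 0 = 1 := rfl

lemma risingCoeff_succ (a : ℝ) (j : ℕ) :
    risingCoeff a (j + 1) = risingCoeff a j * (a + j) / (j + 1) := rfl

lemma succ_mul_risingCoeff_succ (a : ℝ) (j : ℕ) :
    ((j : ℝ) + 1) * risingCoeff a (j + 1) = (a + j) * risingCoeff a j := by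
  rw [risingCoeff_succ]
  have : (j : ℝ) + 1 ≠ 0 := by positivity
  field_simp

lemma iteratedDeriv_one_sub_rpow (a : ℝ) (j : ℕ) {t : ℝ} (ht : t < 1) :
    iteratedDeriv j (fun t : ℝ => (1 - t) ^ (-a)) t
      = j.factorial * risingCoeff a j * (1 - t) ^ (-a - j) := by
  induction j generalizing t with
  | zero => simp
  | succ j ih =>
    have hev : iteratedDeriv j (fun t : ℝ => (1 - t) ^ (-a)) =ᶠ[𝓝 t]
        fun t => j.factorial * risingCoeff a j * (1 - t) ^ (-a - j) := by
      filter_upwards [Iio_mem_nhds ht] with s hs using ih hs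
    have hd : HasDerivAt (fun t : ℝ => j.factorial * risingCoeff a j * (1 - t) ^ (-a - j))
        (j.factorial * risingCoeff a j * (-1 * (-a - j) * (1 - t) ^ (-a - j - 1))) t := by
      refine HasDerivAt.const_mul _ ?_
      have h1 : HasDerivAt (fun t : ℝ => 1 - t) (-1) t := by
        simpa using (hasDerivAt_id t).const_sub 1
      exact h1.rpow_const (Or.inl (by linarith))
    rw [iteratedDeriv_succ, hev.deriv_eq, hd.deriv, Nat.factorial_succ]
    have h := succ_mul_risingCoeff_succ a j
    have he : -a - ((j + 1 : ℕ) : ℝ) = -a - j - 1 := by push_cast; ring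
    rw [he]
    push_cast
    linear_combination -(j.factorial : ℝ) * (1 - t) ^ (-a - j - 1) * h

lemma cesaroNumber_eq_risingCoeff (a : ℝ) (j : ℕ) : cesaroNumber a j = risingCoeff a j := by
  have : (j.factorial : ℝ) ≠ 0 := by positivity
  rw [cesaroNumber, iteratedDeriv_one_sub_rpow a j one_pos]
  simp
  field_simp

lemma risingCoeff_pos {a : ℝ} (ha : 0 < a) (j : ℕ) : 0 < risingCoeff a j := by
  induction j with
  | zero => simp
  | succ j ih => rw [risingCoeff_succ]; positivity

/-- This is where `b` must not be an integer: it permits division by the coefficients of `(1 -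
t)^b`. -/
lemma risingCoeff_neg_ne_zero {b : ℝ} (hb : ∀ m : ℤ, b ≠ m) (j : ℕ) :
    risingCoeff (-b) j ≠ 0 := by
  induction j with
  | zero => simp
  | succ j ih =>
    have h1 : -b + (j : ℝ) ≠ 0 := fun h => hb j (by push_cast; linarith)
    have h2 : (j : ℝ) + 1 ≠ 0 := by positivity
    rw [risingCoeff_succ]
    exact div_ne_zero (mul_ne_zero ih h1) h2

/-- Beyond the index `K > a` the numbers `risingCoeff (-a) j` have a constant sign. -/
lemma exists_sign_risingCoeff_neg {a : ℝ} {K : ℕ} (hK : a < K) :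
    ∃ s : ℝ, |s| = 1 ∧ ∀ j, K ≤ j → 0 ≤ s * risingCoeff (-a) j := by
  obtain ⟨s, hs, h0⟩ : ∃ s : ℝ, |s| = 1 ∧ 0 ≤ s * risingCoeff (-a) K := by
    rcases le_total 0 (risingCoeff (-a) K) with h | h
    · exact ⟨1, by simp, by simpa using h⟩
    · exact ⟨-1, by simp, by simpa using h⟩
  refine ⟨s, hs, fun j hj => ?_⟩
  induction j, hj using Nat.le_induction with
  | base => exact h0
  | succ j hj ih =>
    have : (K : ℝ) ≤ j := by exact_mod_cast hj
    rw [risingCoeff_succ, ← mul_div_assoc, ← mul_assoc]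
    exact div_nonneg (mul_nonneg ih (by linarith)) (by positivity)

/-! ### Convolution and binomial identities -/

/-- The Vandermonde convolution. -/
lemma sum_antidiagonal_risingCoeff_mul (a b : ℝ) (m : ℕ) :
    ∑ p ∈ antidiagonal m, risingCoeff a p.1 * risingCoeff b p.2 = risingCoeff (a + b) m := by
  induction m with
  | zero => simp
  | succ m ih =>
    have hm : ((m : ℝ) + 1) ≠ 0 := by positivity
    apply mul_left_cancel₀ hm
    rw [succ_mul_risingCoeff_succ, ← ih, mul_sum, mul_sum]
    -- Splitting `m + 1 = p.1 + p.2` is the product rule for `t d/dt`, read on coefficients.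
    have h1 : ∑ p ∈ antidiagonal (m + 1), ((m : ℝ) + 1) * (risingCoeff a p.1 * risingCoeff b p.2)
        = ∑ p ∈ antidiagonal (m + 1), (p.1 : ℝ) * risingCoeff a p.1 * risingCoeff b p.2
          + ∑ p ∈ antidiagonal (m + 1), risingCoeff a p.1 * ((p.2 : ℝ) * risingCoeff b p.2) := by
      rw [← sum_add_distrib]
      refine sum_congr rfl fun p hp => ?_
      have : (p.1 : ℝ) + p.2 = m + 1 := by exact_mod_cast mem_antidiagonal.mp hp
      rw [← this]; ring
    rw [h1, Nat.sum_antidiagonal_succ, Nat.sum_antidiagonal_succ']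
    simp only [Nat.cast_zero, zero_mul, mul_zero, zero_add, Nat.cast_add, Nat.cast_one]
    rw [← sum_add_distrib]
    refine sum_congr rfl fun p hp => ?_
    have : (p.1 : ℝ) + p.2 = m := by exact_mod_cast mem_antidiagonal.mp hp
    rw [succ_mul_risingCoeff_succ, succ_mul_risingCoeff_succ, ← this]; ring

/-- Compare coefficients of `t^l` in the `i`-th derivative of `(1 - t)^(-a)` divided by `i!`. -/
lemma risingCoeff_add_mul_choose (a : ℝ) (i l : ℕ) :
    risingCoeff a (i + l) * ((i + l).choose i : ℝ) = risingCoeff a i * risingCoeff (a + i) l := by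
  induction l with
  | zero => simp
  | succ l ih =>
    have h1 := succ_mul_risingCoeff_succ a (i + l)
    have h2 := succ_mul_risingCoeff_succ (a + i) l
    have h3 : ((i + l + 1).choose i : ℝ) * (l + 1) = (i + l).choose i * (i + l + 1) := by
      have := Nat.choose_mul_succ_eq (i + l) i
      rw [show i + l + 1 - i = l + 1 by omega] at this
      exact_mod_cast this.symm
    have hl : (l : ℝ) + 1 ≠ 0 := by positivity
    have hil : (i : ℝ) + l + 1 ≠ 0 := by positivity
    apply mul_left_cancel₀ hl
    rw [← add_assoc]
    push_cast at h1
    apply mul_left_cancel₀ hil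
    calc _ = (((i : ℝ) + l + 1) * risingCoeff a (i + l + 1))
              * (((i + l + 1).choose i : ℝ) * (l + 1)) := by ring
      _ = ((i : ℝ) + l + 1) * (a + i + l) * (risingCoeff a (i + l) * (i + l).choose i) := by
          rw [h1, h3]; ring
      _ = _ := by
          rw [ih]; linear_combination -((i : ℝ) + l + 1) * risingCoeff a i * h2

/-- The convolution of `j ↦ C(j, i) * risingCoeff a j` with `risingCoeff b`. -/
lemma sum_antidiagonal_risingCoeff_mul_choose_mul (a b : ℝ) (hab : ∀ i, risingCoeff (a + b) i ≠ 0)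
    (m i : ℕ) :
    ∑ p ∈ antidiagonal m, risingCoeff a p.1 * (p.1.choose i : ℝ) * risingCoeff b p.2
      = risingCoeff a i / risingCoeff (a + b) i * m.choose i * risingCoeff (a + b) m := by
  rcases lt_or_ge m i with h | h
  · rw [Nat.choose_eq_zero_of_lt h]
    simp only [Nat.cast_zero, mul_zero, zero_mul]
    refine sum_eq_zero fun p hp => ?_
    have := mem_antidiagonal.mp hp
    rw [Nat.choose_eq_zero_of_lt (by omega)]
    simp
  · obtain ⟨l, rfl⟩ := Nat.exists_eq_add_of_le h
    have h1 := risingCoeff_add_mul_choose (a + b) i l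
    have h2 : ∑ p ∈ antidiagonal (i + l), risingCoeff a p.1 * (p.1.choose i : ℝ) * risingCoeff b p.2
        = ∑ p ∈ antidiagonal l, risingCoeff a i * (risingCoeff (a + i) p.1 * risingCoeff b p.2) := by
      symm
      apply sum_of_injOn (fun p : ℕ × ℕ => (i + p.1, p.2))
      · intro p _ q _ hpq
        simp only [Prod.mk.injEq] at hpq
        ext <;> omega
      · intro p hp
        simp at hp ⊢
        omega
      · intro p hp hp'
        have hp1 := mem_antidiagonal.mp hp
        rw [Nat.choose_eq_zero_of_lt]
        · simp
        · by_contra! hc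
          exact hp' ⟨(p.1 - i, p.2), by simp; omega, by ext <;> simp; omega⟩
      · intro p _
        simp only
        rw [risingCoeff_add_mul_choose]; ring
    rw [h2, ← mul_sum, sum_antidiagonal_risingCoeff_mul, show a + (i : ℝ) + b = a + b + i by ring]
    have := hab i
    field_simp
    linear_combination -risingCoeff a i * h1

/-- Inclusion–exclusion for the subsets of size `K` that avoid `j` given elements. -/
lemma choose_sub_eq_sum_choose (K M j : ℕ) (hj : j ≤ M) :
    ((M - j).choose K : ℝ)
      = ∑ i ∈ range (K + 1), (-1) ^ i * (j.choose i : ℝ) * ((M - i).choose (K - i) : ℝ) := by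
  induction j generalizing K M with
  | zero => rw [sum_range_succ']; simp
  | succ j ih =>
    obtain ⟨M, rfl⟩ : ∃ M', M = M' + 1 := ⟨M - 1, by omega⟩
    cases K with
    | zero => simp
    | succ K =>
      have h1 := ih (K + 1) (M + 1) (by omega)
      have h2 := ih K M (by omega)
      have h3 : ((M + 1 - j).choose (K + 1) : ℝ) = (M - j).choose K + (M - j).choose (K + 1) := by
        rw [show M + 1 - j = M - j + 1 by omega, Nat.choose_succ_succ]; push_cast; ring
      rw [show M + 1 - (j + 1) = M - j by omega]
      have h4 : ((M - j).choose (K + 1) : ℝ) = (M + 1 - j).choose (K + 1) - (M - j).choose K := by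
        linarith
      rw [h4, h1, h2, sum_range_succ', sum_range_succ' _ (K + 1), add_sub_right_comm,
        ← sum_sub_distrib]
      congr 1
      · refine sum_congr rfl fun i _ => ?_
        rw [Nat.choose_succ_succ, show M + 1 - (i + 1) = M - i by omega,
          show K + 1 - (i + 1) = K - i by omega]
        push_cast; ring
      · simp

/-! ### Abel summation and multipliers -/

lemma sum_range_mul_sub (φ T : ℕ → ℝ) (L : ℕ) :
    ∑ m ∈ range L, φ m * (T (m + 1) - T m)
      = φ L * T L - φ 0 * T 0 - ∑ m ∈ range L, (φ (m + 1) - φ m) * T (m + 1) := by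
  induction L with
  | zero => simp
  | succ L ih => rw [sum_range_succ, ih, sum_range_succ]; ring

/-- A convergent series has a nonnegative sum if it has nonnegative transforms under multipliers of
uniformly bounded variation that tend to `1`. -/
lemma nonneg_of_multipliers {y : ℕ → ℝ} {B V : ℝ}
    (hy : Tendsto (fun L => ∑ m ∈ range L, y m) atTop (𝓝 B)) {φ : ℕ → ℕ → ℝ}
    (h0 : ∀ᶠ M in atTop, φ M 0 = 1)
    (hV : ∀ᶠ M in atTop, ∀ L, ∑ m ∈ range L, |φ M (m + 1) - φ M m| ≤ V)
    (hδ : ∀ m, Tendsto (fun M => φ M (m + 1) - φ M m) atTop (𝓝 0))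
    (hpos : ∀ᶠ M in atTop, ∃ l, 0 ≤ l ∧
      Tendsto (fun L => ∑ m ∈ range L, φ M m * y m) atTop (𝓝 l)) :
    0 ≤ B := by
  set T : ℕ → ℝ := fun m => ∑ i ∈ range m, y i - B with hT
  have hTy : ∀ m, y m = T (m + 1) - T m := fun m => by simp [hT, sum_range_succ]
  have hT0 : T 0 = -B := by simp [hT]
  have hTlim : Tendsto T atTop (𝓝 0) := by simpa using hy.sub_const B
  have hV0 : 0 ≤ V := by
    obtain ⟨M, hM⟩ := hV.exists
    simpa using hM 0
  -- After Abel summation, `T 0 = -B` contributes `B`, the boundary term at most `(1 + V) * ε` and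
  -- the indices from `m₀` on at most `V * ε`. The finitely many earlier ones vanish as `M → ∞`.
  have key : ∀ ε > 0, 0 ≤ B + ε * (1 + 2 * V) := by
    intro ε hε
    obtain ⟨m₀, hm₀⟩ : ∃ m₀, ∀ m ≥ m₀, |T m| ≤ ε := by
      obtain ⟨m₀, h⟩ := Metric.tendsto_atTop.mp hTlim ε hε
      exact ⟨m₀, fun m hm => by simpa using (h m hm).le⟩
    have hE : Tendsto (fun M => ∑ m ∈ range m₀, |φ M (m + 1) - φ M m| * |T (m + 1)|)
        atTop (𝓝 0) := by
      have := tendsto_finsetSum (range m₀) fun m _ => ((hδ m).abs.mul_const |T (m + 1)|)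
      simpa using this
    have hbound : ∀ᶠ M in atTop,
        0 ≤ B + ε * (1 + 2 * V) + ∑ m ∈ range m₀, |φ M (m + 1) - φ M m| * |T (m + 1)| := by
      filter_upwards [h0, hV, hpos] with M hM0 hMV ⟨l, hl, hlim⟩
      refine hl.trans (le_of_tendsto hlim ?_)
      filter_upwards [eventually_ge_atTop m₀] with L hL
      have hφL : |φ M L| ≤ 1 + V := by
        have h1 : φ M L = 1 + ∑ m ∈ range L, (φ M (m + 1) - φ M m) := by
          rw [sum_range_sub, hM0]; ring
        rw [h1]
        refine (abs_add_le _ _).trans ?_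
        rw [abs_one]
        gcongr
        exact (abs_sum_le_sum_abs _ _).trans (hMV L)
      have h2 : φ M L * T L ≤ (1 + V) * ε := by
        refine (le_abs_self _).trans ?_
        rw [abs_mul]
        have := hm₀ L hL
        gcongr
      have h3 : -∑ m ∈ range L, (φ M (m + 1) - φ M m) * T (m + 1)
          ≤ ∑ m ∈ range m₀, |φ M (m + 1) - φ M m| * |T (m + 1)| + V * ε := by
        calc -∑ m ∈ range L, (φ M (m + 1) - φ M m) * T (m + 1)
            ≤ ∑ m ∈ range L, |φ M (m + 1) - φ M m| * |T (m + 1)| := by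
              refine (neg_le_abs _).trans ((abs_sum_le_sum_abs _ _).trans (le_of_eq ?_))
              simp only [abs_mul]
          _ = ∑ m ∈ range m₀, |φ M (m + 1) - φ M m| * |T (m + 1)|
              + ∑ m ∈ Ico m₀ L, |φ M (m + 1) - φ M m| * |T (m + 1)| :=
              (sum_range_add_sum_Ico _ hL).symm
          _ ≤ ∑ m ∈ range m₀, |φ M (m + 1) - φ M m| * |T (m + 1)|
              + ∑ m ∈ Ico m₀ L, |φ M (m + 1) - φ M m| * ε := by
              gcongr with m hm
              exact hm₀ _ (by have := (mem_Ico.mp hm).1; omega)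
          _ ≤ _ := by
              rw [← sum_mul]
              gcongr
              refine le_trans ?_ (hMV L)
              refine sum_le_sum_of_subset_of_nonneg ?_ fun _ _ _ => abs_nonneg _
              intro m hm
              simp at hm ⊢
              omega
      simp only [hTy]
      rw [sum_range_mul_sub, hM0, hT0]
      linarith
    simpa using ge_of_tendsto (hE.const_add (B + ε * (1 + 2 * V))) hbound
  refine le_of_forall_pos_le_add fun ε hε => ?_
  have h := key (ε / (1 + 2 * V)) (by positivity)
  rwa [div_mul_cancel₀ _ (by positivity)] at h

/-- Summation of a convolution against a sequence, when one factor has finite support. -/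
lemma tendsto_sum_convolution_mul {w e x u : ℕ → ℝ} {J : ℕ} (hw : ∀ j, J ≤ j → w j = 0)
    (hu : ∀ j, Tendsto (fun L => ∑ i ∈ range L, e i * x (i + j)) atTop (𝓝 (u j))) :
    Tendsto (fun L => ∑ m ∈ range L, (∑ p ∈ antidiagonal m, w p.1 * e p.2) * x m) atTop
      (𝓝 (∑ j ∈ range J, w j * u j)) := by
  have h1 : ∀ m, (∑ p ∈ antidiagonal m, w p.1 * e p.2) * x m
      = ∑ j ∈ range J, w j * (if j ≤ m then e (m - j) * x m else 0) := by
    intro m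
    rw [Nat.sum_antidiagonal_eq_sum_range_succ_mk, sum_mul]
    have h2 : ∀ j ∈ range (m + 1), w j * e (m - j) * x m
        = w j * (if j ≤ m then e (m - j) * x m else 0) := by
      intro j hj
      rw [if_pos (by simpa [Nat.lt_succ_iff] using hj), mul_assoc]
    rw [sum_congr rfl h2]
    rcases le_total J (m + 1) with h | h
    · symm
      refine sum_subset (range_subset_range.mpr h) fun j _ hj => ?_
      rw [hw j (by simpa using hj), zero_mul]
    · refine sum_subset (range_subset_range.mpr h) fun j _ hj => ?_
      rw [if_neg (by simp at hj; omega), mul_zero]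
  have h3 : ∀ j L, ∑ m ∈ range L, (if j ≤ m then e (m - j) * x m else 0)
      = ∑ i ∈ range (L - j), e i * x (i + j) := by
    intro j L
    rw [← sum_filter]
    have : (range L).filter (fun m => j ≤ m) = Ico j L := by ext; simp; omega
    rw [this, sum_Ico_eq_sum_range]
    refine sum_congr rfl fun i _ => ?_
    rw [Nat.add_sub_cancel_left, add_comm]
  simp only [h1]
  have h4 : ∀ L, ∑ m ∈ range L, ∑ j ∈ range J, w j * (if j ≤ m then e (m - j) * x m else 0)
      = ∑ j ∈ range J, w j * ∑ i ∈ range (L - j), e i * x (i + j) := by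
    intro L
    rw [sum_comm]
    refine sum_congr rfl fun j _ => ?_
    rw [← mul_sum, h3]
  simp only [h4]
  exact tendsto_finsetSum _ fun j _ => ((hu j).comp (tendsto_sub_atTop_nat j)).const_mul (w j)

/-! ### The taper and its multipliers -/

/-- The coefficients of `(1 - t) ^ (-d)`, tapered to the indices `j ≤ M - K`. -/
noncomputable def taperWeight (d : ℝ) (K M j : ℕ) : ℝ :=
  risingCoeff d j * ((M - j).choose K / M.choose K)

/-- The convolution of the tapered coefficients of `(1 - t) ^ (b - a)` with those of
`(1 - t) ^ a`, relative to the coefficients of `(1 - t) ^ b`. -/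
noncomputable def taperRatio (a b : ℝ) (K M m : ℕ) : ℝ :=
  (∑ p ∈ antidiagonal m, taperWeight (a - b) K M p.1 * risingCoeff (-a) p.2) / risingCoeff (-b) m

lemma taperWeight_nonneg {d : ℝ} (hd : 0 < d) (K M j : ℕ) : 0 ≤ taperWeight d K M j :=
  mul_nonneg (risingCoeff_pos hd j).le (by positivity)

lemma taperWeight_eq_zero (d : ℝ) {K M j : ℕ} (hK : 0 < K) (hj : M - K + 1 ≤ j) :
    taperWeight d K M j = 0 := by
  rw [taperWeight, Nat.choose_eq_zero_of_lt (by omega)]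
  simp

/-- For `j ≤ m ≤ M` the subtraction `M - j` is not truncated, so the taper is a combination of the
`C(j, i)`, `i ≤ K`. Convolution turns each `C(j, i)` into a multiple of `C(m, i)`. -/
lemma taperRatio_eq_sum_of_le {a b : ℝ} (hb : ∀ m : ℤ, b ≠ m) (K : ℕ) {M m : ℕ} (hm : m ≤ M) :
    taperRatio a b K M m = ∑ i ∈ range (K + 1), (-1) ^ i *
      (risingCoeff (a - b) i / risingCoeff (-b) i) * m.choose i *
      ((M - i).choose (K - i) / M.choose K) := by
  have hbm := risingCoeff_neg_ne_zero hb
  have hab : a - b + -a = -b := by ring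
  have hconv := sum_antidiagonal_risingCoeff_mul_choose_mul (a - b) (-a) (by rwa [hab]) m
  rw [hab] at hconv
  rw [taperRatio, div_eq_iff (hbm m), sum_mul]
  have h1 : ∀ p ∈ antidiagonal m, taperWeight (a - b) K M p.1 * risingCoeff (-a) p.2
      = ∑ i ∈ range (K + 1), (-1) ^ i * ((M - i).choose (K - i) / M.choose K) *
        (risingCoeff (a - b) p.1 * (p.1.choose i : ℝ) * risingCoeff (-a) p.2) := by
    intro p hp
    have := mem_antidiagonal.mp hp
    rw [taperWeight, choose_sub_eq_sum_choose K M p.1 (by omega), sum_div, mul_sum, sum_mul]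
    refine sum_congr rfl fun i _ => ?_
    ring
  rw [sum_congr rfl h1, sum_comm]
  refine sum_congr rfl fun i _ => ?_
  rw [← mul_sum, hconv]
  ring

lemma taperRatio_zero (a b : ℝ) {K M : ℕ} (hKM : K ≤ M) : taperRatio a b K M 0 = 1 := by
  have : (M.choose K : ℝ) ≠ 0 := by exact_mod_cast (Nat.choose_pos hKM).ne'
  simp [taperRatio, taperWeight, this]

/-- A bound for `M * |taperRatio a b K M (m + 1) - taperRatio a b K M m|`, `m < M`. -/
noncomputable def taperConst (a b : ℝ) (K : ℕ) : ℝ :=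
  K * ∑ i ∈ range K, |risingCoeff (a - b) (i + 1) / risingCoeff (-b) (i + 1)| * (K - 1).choose i

lemma taperConst_nonneg (a b : ℝ) (K : ℕ) : 0 ≤ taperConst a b K := by
  unfold taperConst; positivity

/-- With `N = M - 1 ≥ m` and `k = K - 1`, this combines `C(N, i) C(N - i, k - i) = C(N, k) C(k, i)`
with `M C(N, k) = K C(M, K)`. -/
lemma choose_mul_choose_div_le {K M m i : ℕ} (hKM : K ≤ M) (hm : m < M) (hi : i < K) :
    (m.choose i : ℝ) * ((M - (i + 1)).choose (K - (i + 1)) / M.choose K)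
      ≤ K * (K - 1).choose i / M := by
  obtain ⟨k, rfl⟩ : ∃ k, K = k + 1 := ⟨K - 1, by omega⟩
  obtain ⟨N, rfl⟩ : ∃ N, M = N + 1 := ⟨M - 1, by omega⟩
  have h1 : m.choose i ≤ N.choose i := Nat.choose_le_choose i (by omega)
  have h2 := Nat.choose_mul (n := N) (k := k) (s := i) (by omega)
  have h3 := Nat.add_one_mul_choose_eq N k
  have hpos : (0 : ℝ) < (N + 1).choose (k + 1) := by exact_mod_cast Nat.choose_pos hKM
  have hM : (0 : ℝ) < ((N + 1 : ℕ) : ℝ) := by positivity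
  rw [show N + 1 - (i + 1) = N - i by omega, show k + 1 - (i + 1) = k - i by omega,
    ← mul_div_assoc, div_le_div_iff₀ hpos hM]
  have h4 : m.choose i * (N - i).choose (k - i) * (N + 1)
      ≤ (k + 1) * k.choose i * (N + 1).choose (k + 1) := by
    calc _ ≤ N.choose i * (N - i).choose (k - i) * (N + 1) := by gcongr
      _ = k.choose i * ((N + 1) * N.choose k) := by rw [← h2]; ring
      _ = _ := by rw [h3]; ring
  simpa using (by exact_mod_cast h4 : ((m.choose i * (N - i).choose (k - i) * (N + 1) : ℕ) : ℝ)
      ≤ ((k + 1) * k.choose i * (N + 1).choose (k + 1) : ℕ))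

lemma abs_taperRatio_succ_sub_le {a b : ℝ} (hb : ∀ m : ℤ, b ≠ m) {K M m : ℕ} (hKM : K ≤ M)
    (hm : m < M) :
    |taperRatio a b K M (m + 1) - taperRatio a b K M m| ≤ taperConst a b K / M := by
  rw [taperRatio_eq_sum_of_le hb K hm, taperRatio_eq_sum_of_le hb K hm.le, ← sum_sub_distrib,
    sum_range_succ']
  simp only [Nat.choose_zero_right, sub_self, add_zero]
  refine (abs_sum_le_sum_abs _ _).trans ?_
  rw [taperConst, mul_sum, sum_div]
  refine sum_le_sum fun i hi => ?_
  have h1 := choose_mul_choose_div_le hKM hm (mem_range.mp hi)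
  have h2 : (-1) ^ (i + 1) * (risingCoeff (a - b) (i + 1) / risingCoeff (-b) (i + 1)) *
        ((m + 1).choose (i + 1) : ℝ) * ((M - (i + 1)).choose (K - (i + 1)) / M.choose K) -
      (-1) ^ (i + 1) * (risingCoeff (a - b) (i + 1) / risingCoeff (-b) (i + 1)) *
        (m.choose (i + 1) : ℝ) * ((M - (i + 1)).choose (K - (i + 1)) / M.choose K)
      = (-1) ^ (i + 1) * (risingCoeff (a - b) (i + 1) / risingCoeff (-b) (i + 1)) *
        ((m.choose i : ℝ) * ((M - (i + 1)).choose (K - (i + 1)) / M.choose K)) := by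
    rw [Nat.choose_succ_succ]; push_cast; ring
  rw [h2, abs_mul, abs_mul, abs_pow, abs_neg, abs_one, one_pow, one_mul,
    abs_of_nonneg (by positivity : (0 : ℝ) ≤
      (m.choose i : ℝ) * ((M - (i + 1)).choose (K - (i + 1)) / M.choose K))]
  calc _ ≤ |risingCoeff (a - b) (i + 1) / risingCoeff (-b) (i + 1)| *
        (K * (K - 1).choose i / M) := by gcongr
    _ = _ := by ring

/-- Since `j ≤ M - K` on the support of the taper, `m - j ≥ K` in every term. When `K > a`, all the
ratios therefore share one sign. -/
lemma taperRatio_eq_sum_of_ge (a b : ℝ) {K M m : ℕ} (hK : 0 < K) (hm : M ≤ m) :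
    taperRatio a b K M m = ∑ j ∈ range (M - K + 1), taperWeight (a - b) K M j *
      (risingCoeff (-a) (m - j) / risingCoeff (-b) m) := by
  rw [taperRatio, Nat.sum_antidiagonal_eq_sum_range_succ_mk, sum_div]
  simp only [mul_div_assoc]
  symm
  refine sum_subset (range_subset_range.mpr (by omega)) fun j _ hj => ?_
  rw [taperWeight_eq_zero _ hK (by simpa using hj), zero_mul]

lemma risingCoeff_ratio_succ {a b : ℝ} {j m : ℕ} (hjm : j ≤ m) (hbm : b < m) :
    risingCoeff (-a) (m + 1 - j) / risingCoeff (-b) (m + 1)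
      = (risingCoeff (-a) (m - j) / risingCoeff (-b) m) *
        (((m - j : ℝ) - a) * (m + 1) / ((m - j + 1) * (m - b))) := by
  have h1 : ((m - j : ℕ) : ℝ) = m - j := by push_cast [hjm]; ring
  have hjm' : (j : ℝ) ≤ m := by exact_mod_cast hjm
  rw [show m + 1 - j = m - j + 1 by omega, risingCoeff_succ, risingCoeff_succ, h1]
  have h2 : (m : ℝ) - j + 1 ≠ 0 := by linarith
  have h3 : (m : ℝ) - b ≠ 0 := by linarith
  have h4 : (-b + m : ℝ) ≠ 0 := by linarith
  have h5 : (m : ℝ) + 1 ≠ 0 := by positivity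
  rw [show (m : ℝ) - b = -b + m by ring]
  field_simp
  ring

/-- Beyond `M` the ratios have a constant sign and decrease in absolute value. -/
lemma exists_sign_taperRatio {a b : ℝ} (hb0 : 0 < b) (hba : b < a) {K M : ℕ} (hK : a < K)
    (hKM : K ≤ M) :
    ∃ s : ℝ, |s| = 1 ∧ ∀ m, M ≤ m → 0 ≤ s * taperRatio a b K M m ∧
      s * taperRatio a b K M (m + 1) ≤ s * taperRatio a b K M m := by
  obtain ⟨s, hs, hsa⟩ := exists_sign_risingCoeff_neg hK
  obtain ⟨s', hs', hsb⟩ := exists_sign_risingCoeff_neg (hba.trans hK)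
  have hK0 : 0 < K := by
    have : (0 : ℝ) < K := by linarith
    exact_mod_cast this
  refine ⟨s * s', by rw [abs_mul, hs, hs', one_mul], fun m hm => ?_⟩
  have hsq : s' * s' = 1 := by rw [← abs_mul_abs_self, hs', one_mul]
  have hq : ∀ j ∈ range (M - K + 1),
      0 ≤ s * s' * (risingCoeff (-a) (m - j) / risingCoeff (-b) m) := by
    intro j hj
    have hj' := mem_range.mp hj
    have e : s * s' * (risingCoeff (-a) (m - j) / risingCoeff (-b) m)
        = (s * risingCoeff (-a) (m - j)) / (s' * risingCoeff (-b) m) := by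
      have : s' ≠ 0 := by rintro rfl; simp at hs'
      by_cases h0 : risingCoeff (-b) m = 0
      · simp [h0]
      · field_simp
        linear_combination risingCoeff (-a) (m - j) * s * hsq
    rw [e]
    exact div_nonneg (hsa _ (by omega)) (hsb _ (by omega))
  rw [taperRatio_eq_sum_of_ge a b hK0 hm, taperRatio_eq_sum_of_ge a b hK0 (hm.trans m.le_succ),
    mul_sum, mul_sum]
  constructor
  · refine sum_nonneg fun j hj => ?_
    rw [mul_left_comm]
    exact mul_nonneg (taperWeight_nonneg (sub_pos.mpr hba) _ _ _) (hq j hj)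
  · refine sum_le_sum fun j hj => ?_
    have hj' := mem_range.mp hj
    have hjm : (j : ℝ) + K ≤ m := by exact_mod_cast (by omega : j + K ≤ m)
    have hj0 : (0 : ℝ) ≤ j := by positivity
    rw [mul_left_comm, mul_left_comm (s * s')]
    refine mul_le_mul_of_nonneg_left ?_ (taperWeight_nonneg (sub_pos.mpr hba) _ _ _)
    rw [risingCoeff_ratio_succ (by omega) (by linarith), ← mul_assoc]
    refine mul_le_of_le_one_right (hq j hj) ?_
    -- After clearing denominators, right side minus left side is `(a - b) * (m + 1) + (b + 1) * j`.
    rw [div_le_one (mul_pos (by linarith) (by linarith))]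
    nlinarith [mul_nonneg hj0 hb0.le, mul_nonneg (sub_pos.mpr hba).le (Nat.cast_nonneg' (α := ℝ) m)]

/-- The `M` increments below `M` add up to at most `taperConst a b K`. Beyond `M` the variation
telescopes to at most the absolute value at `M`, itself at most `1 + taperConst a b K`. -/
lemma sum_abs_taperRatio_succ_sub_le {a b : ℝ} (hb0 : 0 < b) (hba : b < a)
    (hb : ∀ m : ℤ, b ≠ m) {K M : ℕ} (hK : a < K) (hKM : K ≤ M) (L : ℕ) :
    ∑ m ∈ range L, |taperRatio a b K M (m + 1) - taperRatio a b K M m|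
      ≤ 2 * taperConst a b K + 1 := by
  have hC := taperConst_nonneg a b K
  have hM0 : (0 : ℝ) < M := by
    have : (K : ℝ) ≤ M := by exact_mod_cast hKM
    linarith
  obtain ⟨s, hs, hmono⟩ := exists_sign_taperRatio hb0 hba hK hKM
  have hhead : ∑ m ∈ range M, |taperRatio a b K M (m + 1) - taperRatio a b K M m|
      ≤ taperConst a b K := by
    calc _ ≤ ∑ m ∈ range M, taperConst a b K / M :=
          sum_le_sum fun m hm => abs_taperRatio_succ_sub_le hb hKM (mem_range.mp hm)
      _ = _ := by rw [sum_const, card_range, nsmul_eq_mul]; field_simp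
  have hM : s * taperRatio a b K M M ≤ 1 + taperConst a b K := by
    have h1 : taperRatio a b K M M
        = 1 + ∑ m ∈ range M, (taperRatio a b K M (m + 1) - taperRatio a b K M m) := by
      rw [sum_range_sub, taperRatio_zero a b hKM]; ring
    refine (le_abs_self _).trans ?_
    rw [abs_mul, hs, one_mul, h1]
    refine (abs_add_le _ _).trans ?_
    rw [abs_one]
    gcongr
    exact (abs_sum_le_sum_abs _ _).trans hhead
  have htail : ∀ l, ∑ m ∈ range l,
      |taperRatio a b K M (M + m + 1) - taperRatio a b K M (M + m)|
        = s * taperRatio a b K M M - s * taperRatio a b K M (M + l) := by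
    intro l
    induction l with
    | zero => simp
    | succ l ih =>
      have h2 := (hmono (M + l) (by omega)).2
      have h3 : |taperRatio a b K M (M + l + 1) - taperRatio a b K M (M + l)|
          = s * taperRatio a b K M (M + l) - s * taperRatio a b K M (M + l + 1) := by
        rw [← one_mul |_|, ← hs, ← abs_mul, mul_sub, abs_of_nonpos (by linarith)]; ring
      rw [sum_range_succ, ih, h3, add_assoc M l 1]; ring
  calc _ ≤ ∑ m ∈ range (M + L), |taperRatio a b K M (m + 1) - taperRatio a b K M m| :=
        sum_le_sum_of_subset_of_nonneg (range_subset_range.mpr (by omega)) fun _ _ _ => abs_nonneg _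
    _ ≤ _ := by
        rw [sum_range_add, htail]
        have := (hmono (M + L) (by omega)).1
        linarith

/-! ### Conclusion -/

lemma tendsto_sum_fracDiffTerm {a : ℝ} {Λ : ℕ → ℝ} (h : FracDiffWellDefined a Λ) (n : ℕ) :
    Tendsto (fun L => ∑ j ∈ range L, risingCoeff (-a) j * Λ (j + n)) atTop
      (𝓝 (fracDiff a Λ n)) := by
  have h1 := (h n).hasSum
  rw [HasSum, SummationFilter.conditional_filter_eq_map_range, tendsto_map'_iff] at h1
  simpa only [Function.comp_def, fracDiff, fracDiffTerm, cesaroNumber_eq_risingCoeff] using h1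

theorem theorem4p4 (Λ : ℕ → ℝ) (a b : ℝ) (hb : 0 < b) (hba : b < a)
    (hb_int : ∀ m : ℤ, b ≠ (m : ℝ))
    (ha_def : FracDiffWellDefined a Λ) (ha_nonneg : ∀ n : ℕ, 0 ≤ fracDiff a Λ n)
    (hb_def : FracDiffWellDefined b Λ) :
    ∀ n : ℕ, 0 ≤ fracDiff b Λ n := by
  intro n
  obtain ⟨K, hK⟩ := exists_nat_gt a
  have hK0 : 0 < K := by
    have : (0 : ℝ) < K := by linarith
    exact_mod_cast this
  refine nonneg_of_multipliers (tendsto_sum_fracDiffTerm hb_def n)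
    (V := 2 * taperConst a b K + 1) (φ := taperRatio a b K) ?_ ?_ (fun m => ?_) ?_
  · filter_upwards [eventually_ge_atTop K] with M hM using taperRatio_zero a b hM
  · filter_upwards [eventually_ge_atTop K] with M hM L
    exact sum_abs_taperRatio_succ_sub_le hb hba hb_int hK hM L
  · refine squeeze_zero_norm' ?_ (tendsto_const_div_atTop_nhds_zero_nat (taperConst a b K))
    filter_upwards [eventually_ge_atTop K, eventually_gt_atTop m] with M hM hmM
    exact abs_taperRatio_succ_sub_le hb_int hM hmM
  -- This also covers `M < K`, where `M.choose K = 0` and division by zero makes all weights 0.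
  · refine Eventually.of_forall fun M => ⟨∑ j ∈ range (M - K + 1),
      taperWeight (a - b) K M j * fracDiff a Λ (j + n), ?_, ?_⟩
    · exact sum_nonneg fun j _ =>
        mul_nonneg (taperWeight_nonneg (sub_pos.mpr hba) K M j) (ha_nonneg _)
    · have h1 := tendsto_sum_convolution_mul (w := taperWeight (a - b) K M)
        (e := risingCoeff (-a)) (x := fun m => Λ (m + n)) (u := fun j => fracDiff a Λ (j + n))
        (J := M - K + 1) (fun j hj => taperWeight_eq_zero _ hK0 hj)
        (fun j => by simpa only [add_assoc] using tendsto_sum_fracDiffTerm ha_def (j + n))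
      refine h1.congr fun L => sum_congr rfl fun m _ => ?_
      rw [taperRatio, ← mul_assoc, div_mul_cancel₀ _ (risingCoeff_neg_ne_zero hb_int m)]
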